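/- Let $U\subseteq\mathbf R^d$ be open, let $\mathcal D'(U)$ be the space of (complex) Schwartz distributions on $U$ and $\mathcal E'(U)$ the strong dual of $C^\infty(U)$; for $v\in\mathcal E'(U)$ put $\widehat v(\xi)=\langle v,e^{-2\pi i x\cdot\xi}\rangle$. A conic neighborhood of $\xi_0\in\mathbf R^d\setminus\{0\}$ is an open cone $\Gamma\subseteq\mathbf R^d$ containing $\xi_0$. Let $u\in\mathcal D'(U)$, and let $(x_0,\xi_0)\in U\times(\mathbf R^d\setminus\{0\})$; all the sets below are subsets of $U\times(\mathbf R^d\setminus\{0\})$. * Classical wave front set: $(x_0,\xi_0)\notin \operatorname{WF}(u)$ iff there are $\varphi\in C_c^\infty(U)$ with $\varphi(x_0)\ne0$ and a conic neighborhood $\Gamma$ of $\xi_0$ such that for every $N\in\mathbf N$ there is $C$ with $|\widehat{\varphi u}(\xi)|\le C(1+|\xi|)^{-N}$ for $\xi\in\Gamma$. * Gevrey wave front set, $t>1$: $(x_0,\xi_0)\notin\operatorname{WF}_t(u)$ iff there are an open neighborhood $\Omega\subseteq U$ of $x_0$, a conic neighborhood $\Gamma$ of $\xi_0$, a bounded sequence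 $(u_N)_{N\in\mathbf N}$ in $\mathcal E'(U)$ with $u_N=u$ on $\Omega$ for all $N$, and constants $A,h>0$ with $$|\widehat{u_N}(\xi)|\le A\,\frac{h^N N!^{t}}{|\xi|^{N}},\qquad N\ge1,\ \xi\in\Gamma\setminus\{0\}.$$ * For $\tau>0$, $\sigma>1$: $(x_0,\xi_0)\notin\operatorname{WF}_{\{\tau,\sigma\}}(u)$ (resp. $\notin\operatorname{WF}_{(\tau,\sigma)}(u)$) iff there are $\Omega$, $\Gamma$ and a bounded sequence $(u_N)_{N\in\mathbf N}$ in $\mathcal E'(U)$ with $u_N=u$ on $\Omega$ for all $N$, as above, such that $$|\widehat{u_N}(\xi)|\le A\,\frac{h^N N!^{\tau/\sigma}}{|\xi|^{\lfloor N^{1/\sigma}\rfloor}},\qquad N\in\mathbf N,\ \xi\in\Gamma\setminus\{0\},$$ for some $A,h>0$ (resp. for every $h>0$ with some $A=A(h)>0$). Write $\operatorname{WF}_{\tau,\sigma}(u)$ for $\operatorname{WF}_{\{\tau,\sigma\}}(u)$ throughout, or for $\operatorname{WF}_{(\tau,\sigma)}(u)$ throughout, and put $$\operatorname{WF}_{0,1}(u)=\bigcap_{\sigma>1}\bigcap_{\tau>0}\operatorname{WF}_{\tau,\sigma}(u),\quad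 \operatorname{WF}_{\infty,1}(u)=\bigcap_{\sigma>1}\bigcup_{\tau>0}\operatorname{WF}_{\tau,\sigma}(u),$$ $$\operatorname{WF}_{0,\infty}(u)=\bigcup_{\sigma>1}\bigcap_{\tau>0}\operatorname{WF}_{\tau,\sigma}(u),\quad \operatorname{WF}_{\infty,\infty}(u)=\bigcup_{\sigma>1}\bigcup_{\tau>0}\operatorname{WF}_{\tau,\sigma}(u).$$ Then, in both cases, $$\operatorname{WF}(u)\subseteq\operatorname{WF}_{0,1}(u)\subseteq\operatorname{WF}_{\infty,1}(u)\subseteq\operatorname{WF}_{0,\infty}(u)\subseteq\operatorname{WF}_{\infty,\infty}(u)\subseteq\bigcap_{t>1}\operatorname{WF}_t(u).$$ -/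

import Mathlib

open Set TopologicalSpace
open scoped Distributions ContDiff

namespace UltraWF

/-- Euclidean space `ℝ^d`. -/
abbrev Rd (d : ℕ) : Type := EuclideanSpace ℝ (Fin d)

/-! ### The Fréchet space `C^∞(U)` and its strong dual `𝓔'(U)` -/

/-- The complex vector space of smooth complex-valued functions on the open set `U`. A function on
`U` is represented by its extension by zero to `ℝ^d`, so that there is exactly one element for
every smooth function `U → ℂ`. -/
def smoothSubmodule {d : ℕ} (U : Opens (Rd d)) : Submodule ℂ (Rd d → ℂ) where
  carrier := {f | ContDiffOn ℝ ∞ f U ∧ ∀ x ∉ U, f x = 0}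
  add_mem' := fun {f g} hf hg =>
    ⟨hf.1.add hg.1, fun x hx => by simp [hf.2 x hx, hg.2 x hx]⟩
  zero_mem' := ⟨contDiffOn_const, fun _ _ => rfl⟩
  smul_mem' := fun c f hf =>
    ⟨contDiffOn_const.smul hf.1, fun x hx => by simp [hf.2 x hx]⟩

/-- `C^∞(U)`. It is a type of its own, so that it can carry its Fréchet topology. -/
def SmoothFn {d : ℕ} (U : Opens (Rd d)) : Type := smoothSubmodule U

noncomputable instance {d : ℕ} (U : Opens (Rd d)) : AddCommGroup (SmoothFn U) :=
  inferInstanceAs (AddCommGroup (smoothSubmodule U))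

noncomputable instance {d : ℕ} (U : Opens (Rd d)) : Module ℂ (SmoothFn U) :=
  inferInstanceAs (Module ℂ (smoothSubmodule U))

/-- The function on `ℝ^d` (zero outside `U`) underlying an element of `C^∞(U)`. -/
def SmoothFn.toFun {d : ℕ} {U : Opens (Rd d)} (f : SmoothFn U) : Rd d → ℂ := f.1

/-- The restriction to `U` of a function that is smooth on `U`. -/
noncomputable def SmoothFn.restrict {d : ℕ} (U : Opens (Rd d)) (f : Rd d → ℂ)
    (hf : ContDiffOn ℝ ∞ f U) : SmoothFn U :=
  ⟨(U : Set (Rd d)).indicator f,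
    hf.congr fun _ hx => indicator_of_mem hx f, fun _ hx => indicator_of_notMem hx f⟩

theorem SmoothFn.contDiffAt {d : ℕ} {U : Opens (Rd d)} (f : SmoothFn U) {x : Rd d} (hx : x ∈ U)
    (j : ℕ) : ContDiffAt ℝ j f.toFun x :=
  (f.2.1.contDiffAt (U.isOpen.mem_nhds hx)).of_le (by exact_mod_cast le_top)

theorem SmoothFn.continuous_iteratedFDeriv {d : ℕ} {U : Opens (Rd d)} (f : SmoothFn U) (j : ℕ) :
    Continuous fun x : U => iteratedFDeriv ℝ j f.toFun (x : Rd d) := by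
  rw [continuous_iff_continuousAt]
  intro x
  exact ((f.contDiffAt x.2 j).continuousAt_iteratedFDeriv le_rfl).comp
    continuous_subtype_val.continuousAt

/-- All derivatives of a smooth function, as continuous functions on `U`. -/
noncomputable def SmoothFn.jet {d : ℕ} (U : Opens (Rd d)) :
    SmoothFn U →ₗ[ℂ] ((j : ℕ) → C(U, ContinuousMultilinearMap ℝ (fun _ : Fin j => Rd d) ℂ)) where
  toFun f j := ⟨fun x => iteratedFDeriv ℝ j f.toFun (x : Rd d), f.continuous_iteratedFDeriv j⟩
  map_add' f g := by
    ext1 j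
    ext1 x
    exact iteratedFDeriv_add_apply (f.contDiffAt x.2 j) (g.contDiffAt x.2 j)
  map_smul' c f := by
    ext1 j
    ext1 x
    exact iteratedFDeriv_const_smul_apply (f.contDiffAt x.2 j)

/-- The topology of `C^∞(U)`: uniform convergence of all derivatives on all compact subsets of `U`
(the spaces `C(U, ·)` carry the compact-open topology). -/
noncomputable instance {d : ℕ} (U : Opens (Rd d)) : TopologicalSpace (SmoothFn U) :=
  TopologicalSpace.induced (SmoothFn.jet U) inferInstance

noncomputable instance {d : ℕ} (U : Opens (Rd d)) : IsTopologicalAddGroup (SmoothFn U) :=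
  topologicalAddGroup_induced (SmoothFn.jet U)

noncomputable instance {d : ℕ} (U : Opens (Rd d)) : ContinuousSMul ℂ (SmoothFn U) :=
  continuousSMul_induced (SmoothFn.jet U)

/-- `𝓔'(U)`, the compactly supported distributions on `U`: the dual of `C^∞(U)`. Its topology (the
one Mathlib puts on spaces of continuous linear maps) is the strong one: uniform convergence on
bounded subsets of `C^∞(U)`. -/
abbrev CompactDistribution {d : ℕ} (U : Opens (Rd d)) : Type := SmoothFn U →L[ℂ] ℂ

/-- A sequence in `𝓔'(U)` is bounded if its range is a bounded set of the topological vector space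
`𝓔'(U)`. -/
def IsBoundedSeq {d : ℕ} {U : Opens (Rd d)} (v : ℕ → CompactDistribution U) : Prop :=
  Bornology.IsVonNBounded ℂ (range v)

/-! ### Fourier transforms -/

/-- The exponential `x ↦ e^{-2πi x·ξ}`. -/
noncomputable def expFn {d : ℕ} (ξ : Rd d) (x : Rd d) : ℂ :=
  Complex.exp (-(2 * Real.pi * (inner ℝ x ξ : ℝ) : ℝ) * Complex.I)

theorem contDiff_expFn {d : ℕ} (ξ : Rd d) : ContDiff ℝ ∞ (expFn ξ) := by
  have h : ContDiff ℝ ∞ fun x : Rd d => (2 * Real.pi * (inner ℝ x ξ : ℝ) : ℝ) :=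
    contDiff_const.mul (contDiff_id.inner ℝ contDiff_const)
  exact ((Complex.ofRealCLM.contDiff.comp h).neg.mul contDiff_const).cexp

/-- The Fourier transform of `v ∈ 𝓔'(U)`: the function `ξ ↦ ⟨v, e^{-2πi x·ξ}⟩`. -/
noncomputable def fourier {d : ℕ} {U : Opens (Rd d)} (v : CompactDistribution U) (ξ : Rd d) : ℂ :=
  v (SmoothFn.restrict U (expFn ξ) (contDiff_expFn ξ).contDiffOn)

/-- A real test function on `U` as an element of `C^∞(U)`. -/
noncomputable def SmoothFn.ofTest {d : ℕ} {U : Opens (Rd d)} (φ : 𝓓(U, ℝ)) : SmoothFn U :=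
  SmoothFn.restrict U (fun x => (φ x : ℂ))
    (Complex.ofRealCLM.contDiff.comp φ.contDiff).contDiffOn

/-- `v = u` on the open set `Ω`: both agree on the test functions with support in `Ω`. -/
def AgreeOn {d : ℕ} {U : Opens (Rd d)} (v : CompactDistribution U) (u : 𝓓'(U, ℂ))
    (Ω : Set (Rd d)) : Prop :=
  ∀ φ : 𝓓(U, ℝ), tsupport φ ⊆ Ω → v (SmoothFn.ofTest φ) = u φ

/-- The value of a distribution on a complex test function `ψ`, that is
`⟨u, Re ψ⟩ + i ⟨u, Im ψ⟩`. -/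
noncomputable def pairing {d : ℕ} {U : Opens (Rd d)} (u : 𝓓'(U, ℂ)) (ψ : 𝓓(U, ℂ)) : ℂ :=
  u ⟨fun x => (ψ x).re, Complex.reCLM.contDiff.comp ψ.contDiff,
      ψ.hasCompactSupport.comp_left Complex.zero_re,
      (closure_mono (Function.support_comp_subset Complex.zero_re ψ)).trans ψ.tsupport_subset⟩
  + Complex.I *
    u ⟨fun x => (ψ x).im, Complex.imCLM.contDiff.comp ψ.contDiff,
      ψ.hasCompactSupport.comp_left Complex.zero_im,
      (closure_mono (Function.support_comp_subset Complex.zero_im ψ)).trans ψ.tsupport_subset⟩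

/-- The Fourier transform of the compactly supported distribution `φ u`: the function
`ξ ↦ ⟨u, φ e^{-2πi x·ξ}⟩`. -/
noncomputable def fourierCutoff {d : ℕ} {U : Opens (Rd d)} (φ : 𝓓(U, ℂ)) (u : 𝓓'(U, ℂ))
    (ξ : Rd d) : ℂ :=
  pairing u ⟨fun x => φ x * expFn ξ x, φ.contDiff.mul (contDiff_expFn ξ),
    φ.hasCompactSupport.mul_right, (tsupport_mul_subset_left).trans φ.tsupport_subset⟩

/-! ### Wave front sets -/

/-- `Γ` is a conic neighborhood of `ξ₀`: an open cone that contains `ξ₀`. -/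
def IsConicNhd {d : ℕ} (Γ : Set (Rd d)) (ξ₀ : Rd d) : Prop :=
  IsOpen Γ ∧ (∀ r : ℝ, 0 < r → ∀ ξ ∈ Γ, r • ξ ∈ Γ) ∧ ξ₀ ∈ Γ

/-- The classical (`C^∞`) wave front set `WF(u) ⊆ U × (ℝ^d ∖ {0})`. -/
def WF {d : ℕ} (U : Opens (Rd d)) (u : 𝓓'(U, ℂ)) : Set (Rd d × Rd d) :=
  {p | p.1 ∈ U ∧ p.2 ≠ 0 ∧
    ¬ ∃ (φ : 𝓓(U, ℂ)) (Γ : Set (Rd d)), φ p.1 ≠ 0 ∧ IsConicNhd Γ p.2 ∧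
      ∀ N : ℕ, ∃ C : ℝ, ∀ ξ ∈ Γ, ‖fourierCutoff φ u ξ‖ ≤ C / (1 + ‖ξ‖) ^ N}

/-- The data `Ω`, `Γ`, `(u_N)` by which regularity of `u` at `(x₀, ξ₀)` is tested: an open
neighborhood `Ω ⊆ U` of `x₀`, a conic neighborhood `Γ` of `ξ₀`, and a bounded sequence in `𝓔'(U)`
with `u_N = u` on `Ω`. -/
def IsLocalization {d : ℕ} (U : Opens (Rd d)) (u : 𝓓'(U, ℂ)) (x₀ ξ₀ : Rd d)
    (Ω Γ : Set (Rd d)) (v : ℕ → CompactDistribution U) : Prop :=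
  IsOpen Ω ∧ Ω ⊆ U ∧ x₀ ∈ Ω ∧ IsConicNhd Γ ξ₀ ∧ IsBoundedSeq v ∧ ∀ N, AgreeOn (v N) u Ω

/-- The Gevrey wave front set `WF_t(u)`. -/
def WFGevrey {d : ℕ} (U : Opens (Rd d)) (u : 𝓓'(U, ℂ)) (t : ℝ) : Set (Rd d × Rd d) :=
  {p | p.1 ∈ U ∧ p.2 ≠ 0 ∧
    ¬ ∃ (Ω Γ : Set (Rd d)) (v : ℕ → CompactDistribution U), IsLocalization U u p.1 p.2 Ω Γ v ∧
      ∃ A : ℝ, 0 < A ∧ ∃ h : ℝ, 0 < h ∧ ∀ N : ℕ, 1 ≤ N → ∀ ξ ∈ Γ, ξ ≠ 0 →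
        ‖fourier (v N) ξ‖ ≤ A * (h ^ N * (N.factorial : ℝ) ^ t / ‖ξ‖ ^ N)}

/-- The estimate `|û_N(ξ)| ≤ A h^N N!^{τ/σ} / |ξ|^{⌊N^{1/σ}⌋}` for all `N ∈ ℕ` and all nonzero
`ξ ∈ Γ`. -/
def DecayBound {d : ℕ} {U : Opens (Rd d)} (τ σ A h : ℝ) (Γ : Set (Rd d))
    (v : ℕ → CompactDistribution U) : Prop :=
  ∀ N : ℕ, ∀ ξ ∈ Γ, ξ ≠ 0 →
    ‖fourier (v N) ξ‖ ≤ A * (h ^ N * (N.factorial : ℝ) ^ (τ / σ) / ‖ξ‖ ^ ⌊(N : ℝ) ^ (1 / σ)⌋₊)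

/-- The two kinds of regularity: Roumieu `{τ,σ}` and Beurling `(τ,σ)`. -/
inductive Kind
  | roumieu
  | beurling

/-- The quantifiers over the constants: `∃ A h > 0` for Roumieu, `∀ h > 0, ∃ A > 0` for
Beurling. -/
def HasDecay {d : ℕ} {U : Opens (Rd d)} (κ : Kind) (τ σ : ℝ) (Γ : Set (Rd d))
    (v : ℕ → CompactDistribution U) : Prop :=
  match κ with
  | .roumieu => ∃ A : ℝ, 0 < A ∧ ∃ h : ℝ, 0 < h ∧ DecayBound τ σ A h Γ v
  | .beurling => ∀ h : ℝ, 0 < h → ∃ A : ℝ, 0 < A ∧ DecayBound τ σ A h Γ v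

/-- The wave front set `WF_{τ,σ}(u)`: `WF_{{τ,σ}}(u)` in the Roumieu case and `WF_{(τ,σ)}(u)` in the
Beurling case. -/
def WFts {d : ℕ} (κ : Kind) (U : Opens (Rd d)) (u : 𝓓'(U, ℂ)) (τ σ : ℝ) :
    Set (Rd d × Rd d) :=
  {p | p.1 ∈ U ∧ p.2 ≠ 0 ∧
    ¬ ∃ (Ω Γ : Set (Rd d)) (v : ℕ → CompactDistribution U),
      IsLocalization U u p.1 p.2 Ω Γ v ∧ HasDecay κ τ σ Γ v}

/-- `WF_{0,1}(u) = ⋂_{σ>1} ⋂_{τ>0} WF_{τ,σ}(u)`. -/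
def WFZeroOne {d : ℕ} (κ : Kind) (U : Opens (Rd d)) (u : 𝓓'(U, ℂ)) : Set (Rd d × Rd d) :=
  ⋂ σ ∈ Ioi (1 : ℝ), ⋂ τ ∈ Ioi (0 : ℝ), WFts κ U u τ σ

/-- `WF_{∞,1}(u) = ⋂_{σ>1} ⋃_{τ>0} WF_{τ,σ}(u)`. -/
def WFInftyOne {d : ℕ} (κ : Kind) (U : Opens (Rd d)) (u : 𝓓'(U, ℂ)) : Set (Rd d × Rd d) :=
  ⋂ σ ∈ Ioi (1 : ℝ), ⋃ τ ∈ Ioi (0 : ℝ), WFts κ U u τ σ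

/-- `WF_{0,∞}(u) = ⋃_{σ>1} ⋂_{τ>0} WF_{τ,σ}(u)`. -/
def WFZeroInfty {d : ℕ} (κ : Kind) (U : Opens (Rd d)) (u : 𝓓'(U, ℂ)) : Set (Rd d × Rd d) :=
  ⋃ σ ∈ Ioi (1 : ℝ), ⋂ τ ∈ Ioi (0 : ℝ), WFts κ U u τ σ

/-- `WF_{∞,∞}(u) = ⋃_{σ>1} ⋃_{τ>0} WF_{τ,σ}(u)`. -/
def WFInftyInfty {d : ℕ} (κ : Kind) (U : Opens (Rd d)) (u : 𝓓'(U, ℂ)) : Set (Rd d × Rd d) :=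
  ⋃ σ ∈ Ioi (1 : ℝ), ⋃ τ ∈ Ioi (0 : ℝ), WFts κ U u τ σ

end UltraWF

namespace UltraWF

set_option maxSynthPendingDepth 3

open VectorFourier FourierTransform MeasureTheory

/-! Two mechanisms give the whole chain.

Reindexing: suppose `f N ^ q ≤ B * N` with q > 1. Since k log k = O(k^q), the factor h^k k!^t at k =
f(N) is at most exp(D f(N)^q) ≤ e^{DBN}, and this geometric factor is absorbed by h'^N N!^{τ/σ} for
every h' > 0 and every τ > 0. So `HasDecay.of_reindex` turns one bound into bounds of both kinds
with arbitrary τ. It applies when passing from σ₁ to a larger σ₂ (`WFts_subset_WFts`) and from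
Gevrey bounds to any σ > 1 (`WFts_subset_WFGevrey`).

Localization: for φ supported in Ω, the transform of φu is, for every N, the integral of û_N against
translates of one Schwartz function. Rapid decay of that function carries polynomial decay of û_N on
Γ over to a smaller cone (`exists_translate_bound`). As ⌊N^{1/σ}⌋ is unbounded, this yields rapid
decay (`WF_subset_WFts`). The convolution formula needs Fourier inversion in 𝓔'(U): a compactly
supported distribution factors through a Banach space of jets, where continuous functionals commute
with Bochner integrals. -/

/-! ### Derivatives of the exponentials -/

theorem expFn_eq_fourierChar {d : ℕ} (ξ x : Rd d) :
    expFn ξ x = (Real.fourierChar (-(innerSL ℝ ξ x)) : ℂ) := by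
  rw [expFn, Real.fourierChar_apply, innerSL_apply_apply, real_inner_comm]
  congr 1
  push_cast
  ring

theorem norm_expFn {d : ℕ} (ξ x : Rd d) : ‖expFn ξ x‖ = 1 := by
  rw [expFn_eq_fourierChar, Circle.norm_coe]

theorem continuous_expFn_uncurry {d : ℕ} : Continuous fun p : Rd d × Rd d => expFn p.1 p.2 := by
  unfold expFn
  fun_prop

/-- The derivatives of the exponential are explicit. -/
theorem iteratedFDeriv_expFn {d : ℕ} (ξ : Rd d) (n : ℕ) (x : Rd d) :
    iteratedFDeriv ℝ n (expFn ξ) x =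
      fourierPowSMulRight (innerSL ℝ) (fun ζ => expFn ζ x) ξ n := by
  induction n generalizing x with
  | zero =>
    ext m
    simp
  | succ n ih =>
    ext m
    rw [iteratedFDeriv_succ_apply_left, funext ih]
    -- The dependence on x is isolated in a scalar factor times a constant multilinear map, so only
    -- the scalar has to be differentiated.
    have h : (fun x : Rd d => fourierPowSMulRight (innerSL ℝ) (fun ζ => expFn ζ x) ξ n) =
        fun x => expFn ξ x • fourierPowSMulRight (innerSL ℝ) (fun _ => (1 : ℂ)) ξ n := by
      ext x m
      simp
      ring
    have hd : HasFDerivAt (expFn ξ) ((-2 * Real.pi * Complex.I * expFn ξ x) •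
        (Complex.ofRealCLM ∘L (innerSL ℝ ξ))) x := by
      rw [expFn_eq_fourierChar]
      exact (Real.hasFDerivAt_fourierChar_neg_bilinear_right (innerSL ℝ) ξ x).congr_of_eventuallyEq
        (Filter.Eventually.of_forall (expFn_eq_fourierChar ξ))
    rw [h, (hd.smul_const _).fderiv]
    simp only [ContinuousLinearMap.smulRight_apply, smul_apply,
      ContinuousLinearMap.comp_apply, Complex.ofRealCLM_apply,
      fourierPowSMulRight_apply, Fin.prod_univ_succ, Fin.tail, smul_eq_mul, Complex.real_smul,
      pow_succ, Complex.ofReal_mul, mul_one]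
    ring

theorem continuous_iteratedFDeriv_expFn_uncurry {d : ℕ} (n : ℕ) :
    Continuous fun p : Rd d × Rd d => iteratedFDeriv ℝ n (expFn p.1) p.2 := by
  have h : (fun p : Rd d × Rd d => iteratedFDeriv ℝ n (expFn p.1) p.2) =
      fun p => expFn p.1 p.2 • fourierPowSMulRight (innerSL ℝ) (fun _ => (1 : ℂ)) p.1 n := by
    ext p m
    simp [iteratedFDeriv_expFn]
    ring
  rw [h]
  exact continuous_expFn_uncurry.smul
    ((continuous_const.fourierPowSMulRight (innerSL ℝ) n).comp continuous_fst)

theorem norm_iteratedFDeriv_expFn_le {d : ℕ} (ξ : Rd d) (n : ℕ) (x : Rd d) :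
    ‖iteratedFDeriv ℝ n (expFn ξ) x‖ ≤ (2 * Real.pi * ‖ξ‖) ^ n := by
  rw [iteratedFDeriv_expFn]
  refine (norm_fourierPowSMulRight_le _ _ _ _).trans ?_
  rw [norm_expFn, mul_one, ← mul_pow]
  have h : ‖innerSL ℝ (E := Rd d)‖ ≤ 1 := norm_innerSL_le ℝ
  have hp := Real.pi_pos
  gcongr (?_ * _) ^ _
  exact mul_le_of_le_one_right (by positivity) h

/-! ### Compactly supported distributions factor through a Banach space of jets -/

/-- The Banach space of continuous jets of order `m` on the compact set `K`. -/
abbrev JetSpace {d : ℕ} {U : Opens (Rd d)} (K : Compacts U) (m : ℕ) : Type :=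
  (j : Fin (m + 1)) → C(K, ContinuousMultilinearMap ℝ (fun _ : Fin (j : ℕ) => Rd d) ℂ)

/-- The jet of order `m` on `K` of a smooth function. -/
noncomputable def jetOn {d : ℕ} {U : Opens (Rd d)} (K : Compacts U) (m : ℕ) :
    SmoothFn U →ₗ[ℂ] JetSpace K m where
  toFun f j := (SmoothFn.jet U f j).restrict K
  map_add' f g := by rw [map_add]; rfl
  map_smul' c f := by rw [map_smul]; rfl

theorem jetOn_apply {d : ℕ} {U : Opens (Rd d)} (K : Compacts U) (m : ℕ) (f : SmoothFn U)
    (j : Fin (m + 1)) (x : K) :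
    jetOn K m f j x = iteratedFDeriv ℝ (j : ℕ) f.toFun ((x : U) : Rd d) := rfl

/-- Sets of functions that are small on a compact set form a basis at zero. -/
theorem _root_.ContinuousMap.exists_compact_of_mem_nhds_zero {X E : Type*} [TopologicalSpace X]
    [NormedAddCommGroup E] {s : Set C(X, E)} (hs : s ∈ nhds 0) :
    ∃ K : Set X, IsCompact K ∧ ∃ δ : ℝ, 0 < δ ∧ ∀ f : C(X, E), (∀ x ∈ K, ‖f x‖ < δ) → f ∈ s := by
  obtain ⟨⟨K, V⟩, ⟨hK, hV⟩, h⟩ :=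
    (nhds_basis_uniformity' ContinuousMap.hasBasis_compactConvergenceUniformity).mem_iff.1 hs
  obtain ⟨δ, hδ, hδV⟩ := Metric.mem_uniformity_dist.1 hV
  refine ⟨K, hK, δ, hδ, fun f hf => h ?_⟩
  intro x hx
  exact hδV (by simpa using hf x hx)

/-- A neighborhood of zero in C^∞(U) constrains finitely many derivatives, each on one compact set.
The largest order, the union of the compacts and the least tolerance give one jet norm; homogeneity
does the rest. -/
theorem CompactDistribution.exists_jetOn_bound {d : ℕ} {U : Opens (Rd d)}
    (v : CompactDistribution U) :
    ∃ (K : Compacts U) (m : ℕ) (C : ℝ), ∀ f, ‖v f‖ ≤ C * ‖jetOn K m f‖ := by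
  have h0 : v ⁻¹' Metric.ball 0 1 ∈ nhds (0 : SmoothFn U) :=
    v.continuous.continuousAt.preimage_mem_nhds (by simpa using Metric.ball_mem_nhds _ one_pos)
  rw [nhds_induced, map_zero, Filter.mem_comap] at h0
  obtain ⟨t, ht, hts⟩ := h0
  rw [nhds_pi, Filter.mem_pi] at ht
  obtain ⟨I, hI, s, hs, hst⟩ := ht
  choose K hK δ hδ hKs using fun i => ContinuousMap.exists_compact_of_mem_nhds_zero (hs i)
  obtain ⟨m, hm⟩ := hI.bddAbove
  have hKc : IsCompact (⋃ i ∈ I, K i) := hI.isCompact_biUnion fun i _ => hK i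
  obtain ⟨ε, hε, hεδ⟩ : ∃ ε : ℝ, 0 < ε ∧ ∀ i ∈ I, ε ≤ δ i := by
    -- Inserting 1 keeps the set nonempty when no derivative is constrained.
    refine ⟨(insert 1 (hI.toFinset.image δ)).min' (by simp), ?_, fun i hi => ?_⟩
    · rw [Finset.lt_min'_iff]
      intro y hy
      rcases Finset.mem_insert.1 hy with rfl | hy
      · exact one_pos
      · obtain ⟨i, -, rfl⟩ := Finset.mem_image.1 hy
        exact hδ i
    · exact Finset.min'_le _ _ (Finset.mem_insert_of_mem
        (Finset.mem_image_of_mem _ (hI.mem_toFinset.2 hi)))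
  let L : Compacts U := ⟨_, hKc⟩
  have key : ∀ f, ‖jetOn L m f‖ < ε → ‖v f‖ < 1 := by
    intro f hf
    have : f ∈ v ⁻¹' Metric.ball 0 1 := by
      refine hts (hst fun i hi => hKs i _ fun x hx => ?_)
      have hxL : x ∈ L := mem_biUnion hi hx
      calc ‖SmoothFn.jet U f i x‖
          = ‖jetOn L m f ⟨i, Nat.lt_succ_of_le (hm hi)⟩ ⟨x, hxL⟩‖ := rfl
        _ ≤ ‖jetOn L m f ⟨i, Nat.lt_succ_of_le (hm hi)⟩‖ := ContinuousMap.norm_coe_le_norm _ _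
        _ ≤ ‖jetOn L m f‖ := norm_le_pi_norm _ _
        _ < ε := hf
        _ ≤ δ i := hεδ i hi
    simpa using this
  refine ⟨L, m, ε⁻¹ , fun f => ?_⟩
  refine le_of_forall_pos_lt_add fun η hη => ?_
  -- The slack `ε * η` makes the rescaled jet strictly smaller than ε, even when the jet of f
  -- vanishes.
  set a : ℝ := ‖jetOn L m f‖ + ε * η with ha
  have ha0 : 0 < a := by positivity
  have h1 := key (((ε / a : ℝ) : ℂ) • f) (by
    rw [map_smul, norm_smul, Complex.norm_real, Real.norm_of_nonneg (by positivity),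
      div_mul_eq_mul_div, div_lt_iff₀ ha0]
    have : ‖jetOn L m f‖ < a := by rw [ha]; linarith [mul_pos hε hη]
    gcongr)
  rw [map_smul, norm_smul, Complex.norm_real, Real.norm_of_nonneg (by positivity),
      div_mul_eq_mul_div, div_lt_one ha0, ha, ← lt_div_iff₀' hε] at h1
  refine h1.trans_eq ?_
  field_simp

/-- A linear functional that is bounded by the norm of a linear map factors through that map. -/
theorem _root_.LinearMap.exists_strongDual_factor {E F : Type*} [AddCommGroup E] [Module ℂ E]
    [NormedAddCommGroup F] [NormedSpace ℂ F] (J : E →ₗ[ℂ] F) (v : E →ₗ[ℂ] ℂ) (C : ℝ)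
    (hC : ∀ f, ‖v f‖ ≤ C * ‖J f‖) : ∃ V : StrongDual ℂ F, ∀ f, v f = V (J f) := by
  obtain ⟨g, hg⟩ := J.rangeRestrict.exists_rightInverse_of_surjective J.range_rangeRestrict
  have hg' : ∀ y, J (g y) = y := fun y => congrArg Subtype.val (LinearMap.congr_fun hg y)
  let W : StrongDual ℂ (LinearMap.range J) :=
    (v ∘ₗ g).mkContinuous C fun y => by
      have := hC (g y)
      rwa [hg'] at this
  obtain ⟨V, hV, -⟩ := exists_extension_norm_eq _ W
  refine ⟨V, fun f => ?_⟩
  have h1 : V (J f) = v (g ⟨J f, f, rfl⟩) := hV ⟨J f, f, rfl⟩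
  -- f and its chosen representative have the same image under J, so the bound forces v to agree on
  -- them.
  have h2 := hC (f - g ⟨J f, f, rfl⟩)
  rw [map_sub J, hg', sub_self, norm_zero, mul_zero, norm_le_zero_iff, map_sub, sub_eq_zero] at h2
  rw [h1, h2]

/-- A compactly supported distribution is a continuous linear functional of a jet of finite
order on a compact set. -/
theorem CompactDistribution.exists_jetOn_factor {d : ℕ} {U : Opens (Rd d)}
    (v : CompactDistribution U) :
    ∃ (K : Compacts U) (m : ℕ) (V : StrongDual ℂ (JetSpace K m)), ∀ f, v f = V (jetOn K m f) := by
  obtain ⟨K, m, C, hC⟩ := v.exists_jetOn_bound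
  exact ⟨K, m, LinearMap.exists_strongDual_factor (jetOn K m) v.toLinearMap C hC⟩

/-! ### Fourier growth and inversion through jets -/

/-- The exponential as an element of `C^∞(U)`. -/
noncomputable def expSmooth {d : ℕ} (U : Opens (Rd d)) (ξ : Rd d) : SmoothFn U :=
  SmoothFn.restrict U (expFn ξ) (contDiff_expFn ξ).contDiffOn

theorem jetOn_restrict_apply {d : ℕ} {U : Opens (Rd d)} (K : Compacts U) (m : ℕ) (f : Rd d → ℂ)
    (hf : ContDiffOn ℝ ∞ f U) (j : Fin (m + 1)) (x : K) :
    jetOn K m (SmoothFn.restrict U f hf) j x = iteratedFDeriv ℝ (j : ℕ) f ((x : U) : Rd d) := by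
  rw [jetOn_apply]
  refine Filter.EventuallyEq.eq_of_nhds (Filter.EventuallyEq.iteratedFDeriv ℝ ?_ _)
  filter_upwards [U.isOpen.mem_nhds x.1.2] with y hy
  exact indicator_of_mem hy f

/-- Joint continuity in (ξ, x) curries to continuity into the compact-open topology. -/
theorem continuous_jetOn_expSmooth {d : ℕ} {U : Opens (Rd d)} (K : Compacts U) (m : ℕ) :
    Continuous fun ξ => jetOn K m (expSmooth U ξ) := by
  refine continuous_pi fun j => ?_
  let D : C(Rd d × Rd d, ContinuousMultilinearMap ℝ (fun _ : Fin (j : ℕ) => Rd d) ℂ) :=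
    ⟨_, continuous_iteratedFDeriv_expFn_uncurry j⟩
  let i : C(Rd d × K, Rd d × Rd d) := ⟨fun p => (p.1, ((p.2 : U) : Rd d)), by fun_prop⟩
  let F := D.comp i
  exact F.curry.continuous.congr fun ξ =>
    ContinuousMap.ext fun x => (jetOn_restrict_apply K m _ _ j x).symm

theorem norm_jetOn_expSmooth_le {d : ℕ} {U : Opens (Rd d)} (K : Compacts U) (m : ℕ) (ξ : Rd d) :
    ‖jetOn K m (expSmooth U ξ)‖ ≤ (2 * Real.pi) ^ m * (1 + ‖ξ‖) ^ m := by
  have hp := Real.pi_gt_three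
  rw [← mul_pow]
  refine (pi_norm_le_iff_of_nonneg (by positivity)).2 fun j =>
    (ContinuousMap.norm_le _ (by positivity)).2 fun x => ?_
  rw [expSmooth, jetOn_restrict_apply]
  calc _ ≤ (2 * Real.pi * ‖ξ‖) ^ (j : ℕ) := norm_iteratedFDeriv_expFn_le _ _ _
    _ ≤ (2 * Real.pi * (1 + ‖ξ‖)) ^ (j : ℕ) := by gcongr; linarith
    _ ≤ _ := pow_le_pow_right₀ (by nlinarith [norm_nonneg ξ]) (Nat.lt_succ_iff.1 j.2)

/-- The Fourier transform of a compactly supported distribution has polynomial growth. -/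
theorem CompactDistribution.exists_fourier_growth {d : ℕ} {U : Opens (Rd d)}
    (v : CompactDistribution U) :
    ∃ (m : ℕ) (C : ℝ), 0 ≤ C ∧ ∀ ξ, ‖fourier v ξ‖ ≤ C * (1 + ‖ξ‖) ^ m := by
  obtain ⟨K, m, V, hV⟩ := v.exists_jetOn_factor
  refine ⟨m, ‖V‖ * (2 * Real.pi) ^ m, by positivity, fun ξ => ?_⟩
  calc ‖fourier v ξ‖ = ‖V (jetOn K m (expSmooth U ξ))‖ := by rw [← hV]; rfl
    _ ≤ ‖V‖ * ((2 * Real.pi) ^ m * (1 + ‖ξ‖) ^ m) :=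
      V.le_opNorm_of_le (norm_jetOn_expSmooth_le K m ξ)
    _ = _ := by ring

theorem _root_.SchwartzMap.integrable_one_add_norm_pow_mul {d : ℕ} (g : SchwartzMap (Rd d) ℂ) (L : ℕ) :
    Integrable fun η => (1 + ‖η‖) ^ L * ‖g η‖ := by
  refine (((g.integrable_pow_mul volume 0).add (g.integrable_pow_mul volume L)).const_mul
    (2 ^ L)).mono' (by fun_prop) (Filter.Eventually.of_forall fun η => ?_)
  have h2 : (1 + ‖η‖) ^ L ≤ 2 ^ L * (‖η‖ ^ 0 + ‖η‖ ^ L) := by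
    refine (add_pow_le zero_le_one (norm_nonneg η) L).trans ?_
    rw [one_pow, pow_zero]
    gcongr
    · norm_num
    · omega
  rw [Real.norm_of_nonneg (by positivity)]
  calc (1 + ‖η‖) ^ L * ‖g η‖ ≤ 2 ^ L * (‖η‖ ^ 0 + ‖η‖ ^ L) * ‖g η‖ := by gcongr
    _ = _ := by simp only [Pi.add_apply]; ring

/-- Jets of exponentials grow polynomially in ζ and g decays rapidly, so the integral converges in
the Banach space of jets. Point evaluations are continuous and linear, which reduces the identity to
differentiating a Fourier integral under the integral sign. -/
theorem jetOn_fourier {d : ℕ} {U : Opens (Rd d)} (K : Compacts U) (m : ℕ)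
    (g : SchwartzMap (Rd d) ℂ) (hψ : ContDiffOn ℝ ∞ (𝓕 (g : Rd d → ℂ)) U) :
    Integrable (fun ζ => g ζ • jetOn K m (expSmooth U ζ)) ∧
    jetOn K m (SmoothFn.restrict U (𝓕 (g : Rd d → ℂ)) hψ) =
      ∫ ζ, g ζ • jetOn K m (expSmooth U ζ) := by
  have hi : Integrable (fun ζ => g ζ • jetOn K m (expSmooth U ζ)) := by
    have : SecondCountableTopologyEither (Rd d) (JetSpace K m) :=
      secondCountableTopologyEither_of_left _ _
    refine ((g.integrable_one_add_norm_pow_mul m).const_mul ((2 * Real.pi) ^ m)).mono'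
      (g.continuous.smul (continuous_jetOn_expSmooth K m)).aestronglyMeasurable
      (Filter.Eventually.of_forall fun ζ => ?_)
    calc ‖g ζ • jetOn K m (expSmooth U ζ)‖
        ≤ ‖g ζ‖ * ((2 * Real.pi) ^ m * (1 + ‖ζ‖) ^ m) := by
          rw [norm_smul]
          gcongr
          exact norm_jetOn_expSmooth_le K m ζ
      _ = _ := by ring
  refine ⟨hi, ?_⟩
  ext1 j
  ext1 x
  let ev : JetSpace K m →L[ℂ] ContinuousMultilinearMap ℝ (fun _ : Fin (j : ℕ) => Rd d) ℂ :=
    (ContinuousMap.evalCLM ℂ x).comp (ContinuousLinearMap.proj j)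
  change _ = ev (∫ ζ, g ζ • jetOn K m (expSmooth U ζ))
  rw [← ev.integral_comp_comm hi, jetOn_restrict_apply,
    Real.iteratedFDeriv_fourier (N := ⊤) (fun n _ => g.integrable_pow_mul volume n)
      g.continuous.aestronglyMeasurable le_top, Real.fourier_eq]
  refine integral_congr_ae (Filter.Eventually.of_forall fun ζ => ?_)
  have : ev (g ζ • jetOn K m (expSmooth U ζ)) =
    g ζ • iteratedFDeriv ℝ (j : ℕ) (expFn ζ) ((x : U) : Rd d) := by
    rw [map_smul]
    congr 1
    exact jetOn_restrict_apply K m _ _ j x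
  simp only [this]
  ext m
  simp [iteratedFDeriv_expFn, expFn_eq_fourierChar, Circle.smul_def]
  ring

/-- Fourier inversion for a compactly supported distribution. -/
theorem CompactDistribution.apply_fourier {d : ℕ} {U : Opens (Rd d)} (v : CompactDistribution U)
    (g : SchwartzMap (Rd d) ℂ) (hψ : ContDiffOn ℝ ∞ (𝓕 (g : Rd d → ℂ)) U) :
    v (SmoothFn.restrict U (𝓕 (g : Rd d → ℂ)) hψ) = ∫ ζ, g ζ * fourier v ζ := by
  obtain ⟨K, m, V, hV⟩ := v.exists_jetOn_factor
  obtain ⟨hi, h⟩ := jetOn_fourier K m g hψ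
  rw [hV, h, ← V.integral_comp_comm hi]
  refine integral_congr_ae (Filter.Eventually.of_forall fun ζ => ?_)
  simp only [map_smul, smul_eq_mul, ← hV]
  rfl

end UltraWF

namespace UltraWF

open FourierTransform MeasureTheory

/-! ### The classical wave front set is the smallest -/

theorem pairing_eq_of_agreeOn {d : ℕ} {U : Opens (Rd d)} {v : CompactDistribution U}
    {u : 𝓓'(U, ℂ)} {Ω : Set (Rd d)} (h : AgreeOn v u Ω) (ψ : 𝓓(U, ℂ)) (hψ : tsupport ψ ⊆ Ω) :
    pairing u ψ = v (SmoothFn.restrict U ψ ψ.contDiff.contDiffOn) := by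
  have hre : ∀ χ : 𝓓(U, ℝ), (χ : Rd d → ℝ) = Complex.re ∘ ψ → u χ = v (SmoothFn.ofTest χ) :=
    fun χ hχ => (h χ (by
      rw [hχ]
      exact (closure_mono (Function.support_comp_subset Complex.zero_re ψ)).trans hψ)).symm
  have him : ∀ χ : 𝓓(U, ℝ), (χ : Rd d → ℝ) = Complex.im ∘ ψ → u χ = v (SmoothFn.ofTest χ) :=
    fun χ hχ => (h χ (by
      rw [hχ]
      exact (closure_mono (Function.support_comp_subset Complex.zero_im ψ)).trans hψ)).symm
  rw [pairing, hre _ rfl, him _ rfl, ← smul_eq_mul, ← map_smul, ← map_add]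
  congr 1
  refine Subtype.ext (funext fun x => ?_)
  change (U : Set (Rd d)).indicator (fun x => ((ψ x).re : ℂ)) x +
    Complex.I • (U : Set (Rd d)).indicator (fun x => ((ψ x).im : ℂ)) x =
      (U : Set (Rd d)).indicator ψ x
  by_cases hx : x ∈ (U : Set (Rd d))
  · rw [indicator_of_mem hx, indicator_of_mem hx, indicator_of_mem hx, smul_eq_mul, mul_comm,
      Complex.re_add_im]
  · simp [indicator_of_notMem hx]

/-- The Fourier transform of a product is a convolution. -/
theorem exists_fourierCutoff_eq_integral {d : ℕ} {U : Opens (Rd d)} (φ : 𝓓(U, ℂ)) :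
    ∃ g : SchwartzMap (Rd d) ℂ, ∀ (u : 𝓓'(U, ℂ)) (v : CompactDistribution U) (Ω : Set (Rd d)),
      AgreeOn v u Ω → tsupport φ ⊆ Ω →
        ∀ ξ, fourierCutoff φ u ξ = ∫ ζ, g (ζ - ξ) * fourier v ζ := by
  -- Multiplying φ by e^{-2πi x·ξ} translates its inverse transform g to g(ζ - ξ).
  refine ⟨𝓕⁻ (φ.hasCompactSupport.toSchwartzMap φ.contDiff), fun u v Ω h hΩ ξ => ?_⟩
  rw [fourierCutoff, pairing_eq_of_agreeOn h _ (tsupport_mul_subset_left.trans hΩ)]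
  have hc : ContDiff ℝ ∞ fun x => φ x * expFn ξ x := φ.contDiff.mul (contDiff_expFn ξ)
  have hs : HasCompactSupport fun x => φ x * expFn ξ x := φ.hasCompactSupport.mul_right
  let ψ : SchwartzMap (Rd d) ℂ := hs.toSchwartzMap hc
  have hψ : 𝓕 ((𝓕⁻ ψ : SchwartzMap (Rd d) ℂ) : Rd d → ℂ) = fun x => φ x * expFn ξ x := by
    rw [← SchwartzMap.fourier_coe, FourierTransform.fourier_fourierInv_eq]
    rfl
  have key := v.apply_fourier (𝓕⁻ ψ) (by rw [hψ]; exact hc.contDiffOn)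
  simp only [hψ] at key
  refine key.trans (integral_congr_ae (Filter.Eventually.of_forall fun ζ => ?_))
  simp only
  congr 1
  rw [SchwartzMap.fourierInv_coe, SchwartzMap.fourierInv_coe, Real.fourierInv_eq,
    Real.fourierInv_eq]
  refine integral_congr_ae (Filter.Eventually.of_forall fun x => ?_)
  simp only [ψ, HasCompactSupport.toSchwartzMap_toFun, Circle.smul_def, smul_eq_mul]
  rw [expFn_eq_fourierChar, inner_sub_right, sub_eq_add_neg, AddChar.map_add_eq_mul,
    Circle.coe_mul, innerSL_apply_apply, real_inner_comm x ξ]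
  ring

/-! ### Decay on smaller cones -/

/-- Γ' is the cone generated by the ball of half radius around ξ₀. In the ball scaled by r one has
‖ξ‖ ≤ r(‖ξ₀‖ + ε/2), so the chosen c makes η shorter than the remaining margin rε/2. -/
theorem IsConicNhd.exists_shrink {d : ℕ} {Γ : Set (Rd d)} {ξ₀ : Rd d} (h : IsConicNhd Γ ξ₀) :
    ∃ (Γ' : Set (Rd d)) (c : ℝ), IsConicNhd Γ' ξ₀ ∧ 0 < c ∧ c ≤ 1 ∧
      ∀ ξ ∈ Γ', ∀ η : Rd d, ‖η‖ < c * ‖ξ‖ → ξ - η ∈ Γ := by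
  obtain ⟨hopen, hcone, hmem⟩ := h
  obtain ⟨ε, hε, hball⟩ := Metric.isOpen_iff.1 hopen ξ₀ hmem
  refine ⟨⋃ r ∈ Ioi (0 : ℝ), Metric.ball (r • ξ₀) (r * (ε / 2)), ε / 2 / (‖ξ₀‖ + ε / 2),
    ⟨isOpen_biUnion fun _ _ => Metric.isOpen_ball, ?_, ?_⟩, by positivity,
    (div_le_one (by positivity)).2 (by linarith [norm_nonneg ξ₀]), ?_⟩
  · intro r hr ξ hξ
    simp only [mem_iUnion, mem_Ioi, Metric.mem_ball, exists_prop] at hξ ⊢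
    obtain ⟨s, hs, hξ⟩ := hξ
    refine ⟨r * s, mul_pos hr hs, ?_⟩
    rw [mul_smul, dist_smul₀, Real.norm_of_nonneg hr.le, mul_assoc]
    gcongr
  · simp only [mem_iUnion, mem_Ioi, Metric.mem_ball, exists_prop]
    exact ⟨1, one_pos, by simpa using hε⟩
  · intro ξ hξ η hη
    simp only [mem_iUnion, mem_Ioi, Metric.mem_ball, exists_prop, dist_eq_norm] at hξ
    obtain ⟨r, hr, hξ⟩ := hξ
    have hξr : ‖ξ‖ ≤ r * (‖ξ₀‖ + ε / 2) := by
      calc ‖ξ‖ = ‖r • ξ₀ + (ξ - r • ξ₀)‖ := by rw [add_sub_cancel]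
        _ ≤ ‖r • ξ₀‖ + ‖ξ - r • ξ₀‖ := norm_add_le _ _
        _ ≤ r * ‖ξ₀‖ + r * (ε / 2) := by
          rw [norm_smul, Real.norm_of_nonneg hr.le]
          gcongr
        _ = _ := by ring
    have hη' : ‖η‖ < r * (ε / 2) := by
      calc ‖η‖ < ε / 2 / (‖ξ₀‖ + ε / 2) * ‖ξ‖ := hη
        _ ≤ ε / 2 / (‖ξ₀‖ + ε / 2) * (r * (‖ξ₀‖ + ε / 2)) := by gcongr
        _ = r * (ε / 2) := by field_simp
    have hmem' : r⁻¹ • (ξ - η) ∈ Γ := by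
      refine hball ?_
      have he : r⁻¹ • (ξ - η) - ξ₀ = r⁻¹ • ((ξ - r • ξ₀) - η) := by
        rw [smul_sub, smul_sub, smul_sub, inv_smul_smul₀ hr.ne']
        abel
      rw [Metric.mem_ball, dist_eq_norm, he, norm_smul, norm_inv, Real.norm_of_nonneg hr.le,
        inv_mul_lt_iff₀ hr]
      calc ‖(ξ - r • ξ₀) - η‖ ≤ ‖ξ - r • ξ₀‖ + ‖η‖ := norm_sub_le _ _
        _ < r * ε := by linarith
    simpa [smul_inv_smul₀ hr.ne'] using hcone r hr _ hmem'

theorem one_add_norm_le_mul {E : Type*} [SeminormedAddCommGroup E] (ξ ζ : E) :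
    1 + ‖ξ‖ ≤ (1 + ‖ζ‖) * (1 + ‖ζ - ξ‖) := by
  have h : ‖ξ‖ ≤ ‖ζ‖ + ‖ζ - ξ‖ := by
    calc ‖ξ‖ = ‖ζ - (ζ - ξ)‖ := by rw [sub_sub_cancel]
      _ ≤ _ := norm_sub_le _ _
  nlinarith [norm_nonneg ζ, norm_nonneg (ζ - ξ)]

/-- A function of polynomial growth that decays on a cone satisfies, on a smaller cone, a
translation estimate which survives convolution with Schwartz functions. -/
theorem exists_translate_bound {d : ℕ} {Γ Γ' : Set (Rd d)} {c : ℝ} (hc : 0 < c) (hc1 : c ≤ 1)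
    (hΓ : ∀ ξ ∈ Γ', ∀ η : Rd d, ‖η‖ < c * ‖ξ‖ → ξ - η ∈ Γ) {F : Rd d → ℂ} {m M k : ℕ} {B C : ℝ}
    (hC : 0 ≤ C) (hF : ∀ ξ, ‖F ξ‖ ≤ C * (1 + ‖ξ‖) ^ m) (hMk : M ≤ k)
    (hd : ∀ ξ ∈ Γ, ξ ≠ 0 → ‖F ξ‖ ≤ B / ‖ξ‖ ^ k) :
    ∃ (D : ℝ) (L : ℕ), 0 ≤ D ∧ ∀ ξ ∈ Γ', ∀ ζ, ‖F ζ‖ * (1 + ‖ξ‖) ^ M ≤ D * (1 + ‖ζ - ξ‖) ^ L := by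
  have h1 : ∀ ζ ∈ Γ, ‖F ζ‖ * (1 + ‖ζ‖) ^ M ≤ C * 2 ^ (m + M) + |B| * 2 ^ M := by
    intro ζ hζ
    have hB : 0 ≤ |B| * 2 ^ M := by positivity
    -- Near the origin the decay bound degenerates and the growth bound takes over.
    rcases le_or_gt ‖ζ‖ 1 with h | h
    · calc ‖F ζ‖ * (1 + ‖ζ‖) ^ M ≤ C * (1 + ‖ζ‖) ^ m * (1 + ‖ζ‖) ^ M := by gcongr; exact hF ζ
        _ = C * (1 + ‖ζ‖) ^ (m + M) := by ring
        _ ≤ C * 2 ^ (m + M) := by gcongr; linarith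
        _ ≤ _ := by linarith
    · have hpos : 0 < ‖ζ‖ := one_pos.trans h
      have hC' : 0 ≤ C * 2 ^ (m + M) := by positivity
      calc ‖F ζ‖ * (1 + ‖ζ‖) ^ M ≤ |B| / ‖ζ‖ ^ k * (2 * ‖ζ‖) ^ M := by
            gcongr
            · exact (hd ζ hζ (norm_pos_iff.1 hpos)).trans (by gcongr; exact le_abs_self B)
            · linarith
        _ = |B| * 2 ^ M * (‖ζ‖ ^ M / ‖ζ‖ ^ k) := by rw [mul_pow]; ring
        _ ≤ |B| * 2 ^ M * 1 := by
            gcongr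
            exact (div_le_one (by positivity)).2 (pow_le_pow_right₀ h.le hMk)
        _ ≤ _ := by linarith
  refine ⟨C * 2 ^ (m + M) + |B| * 2 ^ M + C * (c⁻¹ * 2) ^ (m + M), 2 * m + M, by positivity, ?_⟩
  intro ξ hξ ζ
  have hw : 1 ≤ 1 + ‖ζ - ξ‖ := by linarith [norm_nonneg (ζ - ξ)]
  -- If ζ is close to ξ relative to ‖ξ‖, it lies in Γ and decay applies; otherwise ‖ξ‖ ≤ c⁻¹‖ζ - ξ‖,
  -- and all powers of 1 + ‖ξ‖ are paid for by ‖ζ - ξ‖.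
  by_cases h : ‖ξ - ζ‖ < c * ‖ξ‖
  · have hζ : ζ ∈ Γ := by simpa using hΓ ξ hξ _ h
    calc ‖F ζ‖ * (1 + ‖ξ‖) ^ M ≤ ‖F ζ‖ * ((1 + ‖ζ‖) * (1 + ‖ζ - ξ‖)) ^ M := by
          gcongr; exact one_add_norm_le_mul ξ ζ
      _ = ‖F ζ‖ * (1 + ‖ζ‖) ^ M * (1 + ‖ζ - ξ‖) ^ M := by rw [mul_pow]; ring
      _ ≤ (C * 2 ^ (m + M) + |B| * 2 ^ M) * (1 + ‖ζ - ξ‖) ^ M := by gcongr; exact h1 ζ hζ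
      _ ≤ (C * 2 ^ (m + M) + |B| * 2 ^ M + C * (c⁻¹ * 2) ^ (m + M)) *
          (1 + ‖ζ - ξ‖) ^ (2 * m + M) := by
        refine mul_le_mul ?_ (pow_le_pow_right₀ hw (by omega)) (by positivity) (by positivity)
        exact le_add_of_nonneg_right (by positivity)
  · rw [not_lt, norm_sub_rev] at h
    have hξ1 : 1 + ‖ξ‖ ≤ c⁻¹ * 2 * (1 + ‖ζ - ξ‖) := by
      have h3 : ‖ξ‖ ≤ c⁻¹ * ‖ζ - ξ‖ := by
        rw [le_inv_mul_iff₀ hc]; exact h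
      have h4 : 1 ≤ c⁻¹ := (one_le_inv₀ hc).2 hc1
      nlinarith [norm_nonneg (ζ - ξ)]
    have hζ1 : 1 + ‖ζ‖ ≤ (1 + ‖ξ‖) * (1 + ‖ζ - ξ‖) := by
      rw [norm_sub_rev]; exact one_add_norm_le_mul ζ ξ
    calc ‖F ζ‖ * (1 + ‖ξ‖) ^ M ≤ C * ((1 + ‖ξ‖) * (1 + ‖ζ - ξ‖)) ^ m * (1 + ‖ξ‖) ^ M := by
          gcongr
          exact (hF ζ).trans (by gcongr)
      _ = C * (1 + ‖ξ‖) ^ (m + M) * (1 + ‖ζ - ξ‖) ^ m := by rw [mul_pow]; ring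
      _ ≤ C * (c⁻¹ * 2 * (1 + ‖ζ - ξ‖)) ^ (m + M) * (1 + ‖ζ - ξ‖) ^ m := by gcongr
      _ = C * (c⁻¹ * 2) ^ (m + M) * (1 + ‖ζ - ξ‖) ^ (2 * m + M) := by rw [mul_pow]; ring
      _ ≤ _ := by
        gcongr
        have : 0 ≤ C * 2 ^ (m + M) + |B| * 2 ^ M := by positivity
        linarith

theorem HasDecay.exists_decayBound {d : ℕ} {U : Opens (Rd d)} {κ : Kind} {τ σ : ℝ}
    {Γ : Set (Rd d)} {v : ℕ → CompactDistribution U} (h : HasDecay κ τ σ Γ v) :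
    ∃ A : ℝ, 0 < A ∧ ∃ h : ℝ, 0 < h ∧ DecayBound τ σ A h Γ v := by
  cases κ with
  | roumieu => exact h
  | beurling =>
    obtain ⟨A, hA, hb⟩ := h 1 one_pos
    exact ⟨A, hA, 1, one_pos, hb⟩

/-- Each order M of decay uses a single u_N, so the constants may depend on N; h, τ and the
factorial only enter through them. -/
theorem WF_subset_WFts {d : ℕ} (κ : Kind) (U : Opens (Rd d)) (u : 𝓓'(U, ℂ)) {τ σ : ℝ}
    (hσ : 1 < σ) : WF U u ⊆ WFts κ U u τ σ := by
  rintro ⟨x₀, ξ₀⟩ ⟨hx₀, hξ₀, hn⟩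
  refine ⟨hx₀, hξ₀, ?_⟩
  rintro ⟨Ω, Γ, v, ⟨hΩ, hΩU, hxΩ, hΓ, -, hagree⟩, hdec⟩
  obtain ⟨A, hA, h, hh, hb⟩ := hdec.exists_decayBound
  obtain ⟨f, hfΩ, hfc, hfs, -, hf1⟩ :=
    exists_contDiff_tsupport_subset (n := ⊤) (hΩ.mem_nhds hxΩ)
  have hfsupp : tsupport (fun x => (f x : ℂ)) ⊆ Ω :=
    (closure_mono (Function.support_comp_subset Complex.ofReal_zero f)).trans hfΩ
  let φ : 𝓓(U, ℂ) := ⟨fun x => (f x : ℂ), Complex.ofRealCLM.contDiff.comp hfs,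
    hfc.comp_left Complex.ofReal_zero, hfsupp.trans hΩU⟩
  obtain ⟨Γ', c, hΓ', hc, hc1, hsub⟩ := hΓ.exists_shrink
  refine hn ⟨φ, Γ', ?_, hΓ', fun M => ?_⟩
  · change (f x₀ : ℂ) ≠ 0
    rw [hf1]
    simp
  obtain ⟨g, hg⟩ := exists_fourierCutoff_eq_integral φ
  have hσ0 : 0 < σ := one_pos.trans hσ
  -- This N makes the exponent ⌊N^{1/σ}⌋ at least M.
  set N : ℕ := ⌈(M : ℝ) ^ σ⌉₊ with hN
  have hMN : M ≤ ⌊(N : ℝ) ^ (1 / σ)⌋₊ := by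
    refine Nat.le_floor ?_
    calc (M : ℝ) = ((M : ℝ) ^ σ) ^ (1 / σ) := by
          rw [← Real.rpow_mul (Nat.cast_nonneg M), mul_one_div_cancel hσ0.ne', Real.rpow_one]
      _ ≤ (N : ℝ) ^ (1 / σ) := by gcongr; exact Nat.le_ceil _
  obtain ⟨m, C, hC, hgrowth⟩ := (v N).exists_fourier_growth
  obtain ⟨D, L, hD, hDL⟩ := exists_translate_bound hc hc1 hsub hC hgrowth hMN
    (B := A * (h ^ N * (N.factorial : ℝ) ^ (τ / σ)))
    (fun ξ hξ h0 => (hb N ξ hξ h0).trans_eq (by ring))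
  have hint := g.integrable_one_add_norm_pow_mul L
  refine ⟨D * ∫ η, (1 + ‖η‖) ^ L * ‖g η‖, fun ξ hξ => ?_⟩
  rw [hg u (v N) Ω (hagree N) hfsupp ξ, le_div_iff₀ (by positivity), mul_comm]
  have hscale : (1 + ‖ξ‖) ^ M * ‖∫ ζ, g (ζ - ξ) * fourier (v N) ζ‖ =
      ‖∫ ζ, (((1 + ‖ξ‖) ^ M : ℝ) : ℂ) * (g (ζ - ξ) * fourier (v N) ζ)‖ := by
    rw [integral_const_mul, norm_mul, Complex.norm_real, Real.norm_of_nonneg (by positivity)]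
  -- Translating the dominating integral by ξ makes the constant independent of ξ.
  rw [hscale, ← integral_const_mul,
    ← integral_sub_right_eq_self (fun η => D * ((1 + ‖η‖) ^ L * ‖g η‖)) ξ]
  refine norm_integral_le_of_norm_le ((hint.const_mul D).comp_sub_right ξ)
    (Filter.Eventually.of_forall fun ζ => ?_)
  rw [norm_mul, norm_mul, Complex.norm_real, Real.norm_of_nonneg (by positivity)]
  calc (1 + ‖ξ‖) ^ M * (‖g (ζ - ξ)‖ * ‖fourier (v N) ζ‖)
      = ‖fourier (v N) ζ‖ * (1 + ‖ξ‖) ^ M * ‖g (ζ - ξ)‖ := by ring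
    _ ≤ D * (1 + ‖ζ - ξ‖) ^ L * ‖g (ζ - ξ)‖ :=
      mul_le_mul_of_nonneg_right (hDL ξ hξ ζ) (norm_nonneg _)
    _ = _ := by ring

end UltraWF

namespace UltraWF

/-! ### Reindexing localizing sequences -/

/-- Apply x^N / N! ≤ e^x to x = c^{1/s} and raise to the power s. This absorption makes h and τ
immaterial after reindexing. -/
theorem exists_pow_le_factorial_rpow {c s : ℝ} (hc : 0 ≤ c) (hs : 0 < s) :
    ∃ A : ℝ, 0 < A ∧ ∀ N : ℕ, c ^ N ≤ A * (N.factorial : ℝ) ^ s := by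
  refine ⟨Real.exp (c ^ (1 / s)) ^ s, by positivity, fun N => ?_⟩
  have h := Real.pow_div_factorial_le_exp (c ^ (1 / s)) (by positivity) N
  rw [div_le_iff₀ (by positivity)] at h
  calc c ^ N = ((c ^ (1 / s)) ^ N) ^ s := by
        rw [← Real.rpow_natCast, ← Real.rpow_natCast, ← Real.rpow_mul hc, ← Real.rpow_mul hc]
        congr 1
        field_simp
    _ ≤ (Real.exp (c ^ (1 / s)) * N.factorial) ^ s := by gcongr
    _ = _ := Real.mul_rpow (by positivity) (by positivity)

/-- Use k! ≤ k^k and log k ≤ k^{q-1}/(q-1). -/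
theorem exists_factorial_rpow_le_exp {h t q : ℝ} (hh : 0 < h) (ht : 0 ≤ t) (hq : 1 < q) :
    ∃ D : ℝ, 0 ≤ D ∧ ∀ k : ℕ,
      h ^ k * (k.factorial : ℝ) ^ t ≤ Real.exp (D * (k : ℝ) ^ q) := by
  refine ⟨|Real.log h| + t * (q - 1)⁻¹, by have := sub_pos.2 hq; positivity, fun k => ?_⟩
  rcases Nat.eq_zero_or_pos k with rfl | hk
  · simp [Real.zero_rpow (one_pos.trans hq).ne']
  have hk1 : (1 : ℝ) ≤ k := by exact_mod_cast hk
  have hk0 : (0 : ℝ) < k := by exact_mod_cast hk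
  have hkq : (k : ℝ) ≤ (k : ℝ) ^ q := by
    simpa using Real.rpow_le_rpow_of_exponent_le hk1 hq.le
  have hlog : (k : ℝ) * Real.log k ≤ (q - 1)⁻¹ * (k : ℝ) ^ q := by
    have := Real.log_le_rpow_div hk0.le (sub_pos.2 hq)
    calc (k : ℝ) * Real.log k ≤ k * ((k : ℝ) ^ (q - 1) / (q - 1)) := by gcongr
      _ = _ := by
        rw [Real.rpow_sub_one hk0.ne']
        field_simp
  have hfac : (k.factorial : ℝ) ≤ Real.exp (k * Real.log k) := by
    rw [mul_comm, ← Real.rpow_def_of_pos hk0, Real.rpow_natCast]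
    exact_mod_cast Nat.factorial_le_pow k
  calc h ^ k * (k.factorial : ℝ) ^ t
      ≤ Real.exp (Real.log h * k) * Real.exp (k * Real.log k) ^ t := by
        rw [← Real.rpow_def_of_pos hh, Real.rpow_natCast]
        gcongr
    _ = Real.exp (Real.log h * k + t * (k * Real.log k)) := by
        rw [← Real.exp_mul, ← Real.exp_add]
        ring_nf
    _ ≤ _ := by
        rw [Real.exp_le_exp, add_mul, mul_assoc t]
        have : Real.log h * k ≤ |Real.log h| * (k : ℝ) ^ q :=
          mul_le_mul (le_abs_self _) hkq hk0.le (abs_nonneg _)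
        gcongr

theorem IsLocalization.comp {d : ℕ} {U : Opens (Rd d)} {u : 𝓓'(U, ℂ)} {x₀ ξ₀ : Rd d}
    {Ω Γ : Set (Rd d)} {v : ℕ → CompactDistribution U} (h : IsLocalization U u x₀ ξ₀ Ω Γ v)
    (f : ℕ → ℕ) : IsLocalization U u x₀ ξ₀ Ω Γ (v ∘ f) :=
  ⟨h.1, h.2.1, h.2.2.1, h.2.2.2.1, h.2.2.2.2.1.subset (range_comp_subset_range f v),
    fun N => h.2.2.2.2.2 (f N)⟩

/-- The exponents must match exactly: a larger power of ‖ξ‖ would weaken the bound where ‖ξ‖ < 1, a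
smaller one where ‖ξ‖ > 1. -/
theorem HasDecay.of_reindex {d : ℕ} {U : Opens (Rd d)} (κ : Kind) {τ σ A h t q B : ℝ}
    {Γ : Set (Rd d)} {v : ℕ → CompactDistribution U} {f e : ℕ → ℕ} (hτ : 0 < τ) (hσ : 0 < σ)
    (hA : 0 < A) (hh : 0 < h) (ht : 0 ≤ t) (hq : 1 < q)
    (hv : ∀ M : ℕ, ∀ ξ ∈ Γ, ξ ≠ 0 →
      ‖fourier (v M) ξ‖ ≤ A * (h ^ M * (M.factorial : ℝ) ^ t / ‖ξ‖ ^ e M))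
    (hf : ∀ N : ℕ, (f N : ℝ) ^ q ≤ B * N) (he : ∀ N : ℕ, e (f N) = ⌊(N : ℝ) ^ (1 / σ)⌋₊) :
    HasDecay κ τ σ Γ (v ∘ f) := by
  have key : ∀ h' : ℝ, 0 < h' → ∃ A' : ℝ, 0 < A' ∧ DecayBound τ σ A' h' Γ (v ∘ f) := by
    intro h' hh'
    obtain ⟨D, hD, hDk⟩ := exists_factorial_rpow_le_exp hh ht hq
    obtain ⟨A₂, hA₂, hA₂N⟩ := exists_pow_le_factorial_rpow (c := Real.exp (D * B) / h')
      (by positivity) (div_pos hτ hσ)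
    refine ⟨A * A₂, by positivity, fun N ξ hξ h0 => ?_⟩
    refine (hv (f N) ξ hξ h0).trans ?_
    rw [he, mul_assoc A, ← mul_div_assoc A₂]
    refine mul_le_mul_of_nonneg_left (div_le_div_of_nonneg_right ?_ (by positivity)) hA.le
    calc h ^ f N * ((f N).factorial : ℝ) ^ t ≤ Real.exp (D * (f N : ℝ) ^ q) := hDk _
      _ ≤ Real.exp (D * (B * N)) := by gcongr; exact hf N
      _ = h' ^ N * (Real.exp (D * B) / h') ^ N := by
        rw [← mul_pow, mul_div_cancel₀ _ hh'.ne', ← Real.exp_nat_mul]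
        ring_nf
      _ ≤ h' ^ N * (A₂ * (N.factorial : ℝ) ^ (τ / σ)) := by gcongr; exact hA₂N N
      _ = _ := by ring
  cases κ with
  | roumieu =>
    obtain ⟨A', hA', hb⟩ := key 1 one_pos
    exact ⟨A', hA', 1, one_pos, hb⟩
  | beurling => exact key

/-- Superadditivity gives k^σ ≤ ⌈k^σ⌉ < k^σ + 1 ≤ (k+1)^σ; take σ-th roots. -/
theorem floor_rpow_ceil_rpow {σ : ℝ} (hσ : 1 < σ) (k : ℕ) :
    ⌊(⌈(k : ℝ) ^ σ⌉₊ : ℝ) ^ (1 / σ)⌋₊ = k := by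
  have hσ0 : 0 < σ := one_pos.trans hσ
  have hinv : ∀ x : ℝ, 0 ≤ x → (x ^ σ) ^ (1 / σ) = x := fun x hx => by
    rw [← Real.rpow_mul hx, mul_one_div_cancel hσ0.ne', Real.rpow_one]
  rw [Nat.floor_eq_iff (by positivity)]
  constructor
  · calc (k : ℝ) = ((k : ℝ) ^ σ) ^ (1 / σ) := (hinv _ (Nat.cast_nonneg k)).symm
      _ ≤ _ := by gcongr; exact Nat.le_ceil _
  · calc (⌈(k : ℝ) ^ σ⌉₊ : ℝ) ^ (1 / σ) < (((k : ℝ) + 1) ^ σ) ^ (1 / σ) := by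
          refine Real.rpow_lt_rpow (by positivity) ?_ (by positivity)
          calc (⌈(k : ℝ) ^ σ⌉₊ : ℝ) < (k : ℝ) ^ σ + 1 := Nat.ceil_lt_add_one (by positivity)
            _ = (k : ℝ) ^ σ + 1 ^ σ := by rw [Real.one_rpow]
            _ ≤ ((k : ℝ) + 1) ^ σ :=
              Real.add_rpow_le_rpow_add (Nat.cast_nonneg k) zero_le_one hσ.le
      _ = (k : ℝ) + 1 := hinv _ (by positivity)

theorem ceil_rpow_le_two_mul {σ : ℝ} (hσ : 0 < σ) (k : ℕ) :
    (⌈(k : ℝ) ^ σ⌉₊ : ℝ) ≤ 2 * (k : ℝ) ^ σ := by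
  rcases Nat.eq_zero_or_pos k with rfl | hk
  · simp [Real.zero_rpow hσ.ne']
  · have h1 : (1 : ℝ) ≤ (k : ℝ) ^ σ := Real.one_le_rpow (by exact_mod_cast hk) hσ.le
    have := Nat.ceil_lt_add_one (zero_le_one.trans h1)
    linarith

theorem floor_rpow_rpow_le {σ : ℝ} (hσ : 0 < σ) (N : ℕ) :
    (⌊(N : ℝ) ^ (1 / σ)⌋₊ : ℝ) ^ σ ≤ N := by
  calc (⌊(N : ℝ) ^ (1 / σ)⌋₊ : ℝ) ^ σ ≤ ((N : ℝ) ^ (1 / σ)) ^ σ := by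
        gcongr; exact Nat.floor_le (by positivity)
    _ = N := by
      rw [← Real.rpow_mul (Nat.cast_nonneg N), one_div_mul_cancel hσ.ne', Real.rpow_one]

/-- Regularity improves when `σ` grows, whatever the values of `τ`. -/
theorem WFts_subset_WFts {d : ℕ} (κ : Kind) (U : Opens (Rd d)) (u : 𝓓'(U, ℂ)) {τ₁ τ₂ σ₁ σ₂ : ℝ}
    (hτ₁ : 0 < τ₁) (hτ₂ : 0 < τ₂) (hσ₁ : 1 < σ₁) (hσ : σ₁ < σ₂) :
    WFts κ U u τ₂ σ₂ ⊆ WFts κ U u τ₁ σ₁ := by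
  rintro ⟨x₀, ξ₀⟩ ⟨hx₀, hξ₀, hn⟩
  refine ⟨hx₀, hξ₀, ?_⟩
  rintro ⟨Ω, Γ, v, hloc, hdec⟩
  obtain ⟨A, hA, h, hh, hb⟩ := hdec.exists_decayBound
  have hσ₁0 : 0 < σ₁ := one_pos.trans hσ₁
  have hσ₂0 : 0 < σ₂ := hσ₁0.trans hσ
  have hq0 : 0 < σ₂ / σ₁ := div_pos hσ₂0 hσ₁0
  -- The inner floor is the target exponent k; ⌈k^{σ₁}⌉ is an index whose σ₁-exponent is exactly k,
  -- and it is at most 2N^{σ₁/σ₂}. Hence q = σ₂/σ₁ > 1.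
  refine hn ⟨Ω, Γ, _, hloc.comp fun N => ⌈(⌊(N : ℝ) ^ (1 / σ₂)⌋₊ : ℝ) ^ σ₁⌉₊,
    HasDecay.of_reindex κ hτ₂ hσ₂0 hA hh (div_pos hτ₁ hσ₁0).le ((one_lt_div hσ₁0).2 hσ) hb
      (B := 2 ^ (σ₂ / σ₁)) (fun N => ?_) fun N => floor_rpow_ceil_rpow hσ₁ _⟩
  calc (⌈(⌊(N : ℝ) ^ (1 / σ₂)⌋₊ : ℝ) ^ σ₁⌉₊ : ℝ) ^ (σ₂ / σ₁)
      ≤ (2 * (⌊(N : ℝ) ^ (1 / σ₂)⌋₊ : ℝ) ^ σ₁) ^ (σ₂ / σ₁) := by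
        gcongr; exact ceil_rpow_le_two_mul hσ₁0 _
    _ = 2 ^ (σ₂ / σ₁) * (⌊(N : ℝ) ^ (1 / σ₂)⌋₊ : ℝ) ^ σ₂ := by
        rw [Real.mul_rpow (by norm_num) (by positivity), ← Real.rpow_mul (Nat.cast_nonneg _),
          mul_div_cancel₀ _ hσ₁0.ne']
    _ ≤ _ := by gcongr; exact floor_rpow_rpow_le hσ₂0 N

/-- Gevrey regularity implies `{τ,σ}` and `(τ,σ)` regularity. -/
theorem WFts_subset_WFGevrey {d : ℕ} (κ : Kind) (U : Opens (Rd d)) (u : 𝓓'(U, ℂ)) {τ σ t : ℝ}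
    (hτ : 0 < τ) (hσ : 1 < σ) (ht : 0 ≤ t) : WFts κ U u τ σ ⊆ WFGevrey U u t := by
  rintro ⟨x₀, ξ₀⟩ ⟨hx₀, hξ₀, hn⟩
  refine ⟨hx₀, hξ₀, ?_⟩
  rintro ⟨Ω, Γ, v, hloc, A, hA, h, hh, hb⟩
  have hσ0 : 0 < σ := one_pos.trans hσ
  obtain ⟨m, C, hC, hgrowth⟩ := (v 1).exists_fourier_growth
  -- Gevrey bounds start at N = 1, but the reindexing reaches 0, where u_1 is used. There û_1 is
  -- bounded by `C * 2 ^ m` for ‖ξ‖ ≤ 1 (growth) and by `A * h` for ‖ξ‖ ≥ 1 (the bound for N = 1).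
  let A' : ℝ := A + A * h + C * 2 ^ m
  have hA' : A ≤ A' := by
    have : 0 ≤ A * h + C * 2 ^ m := by positivity
    simp only [A']
    linarith
  have hv : ∀ M : ℕ, ∀ ξ ∈ Γ, ξ ≠ 0 → ‖fourier ((v ∘ fun M => max 1 M) M) ξ‖ ≤
      A' * (h ^ M * (M.factorial : ℝ) ^ t / ‖ξ‖ ^ M) := by
    intro M ξ hξ h0
    have hpos : 0 < ‖ξ‖ := norm_pos_iff.2 h0
    rcases Nat.eq_zero_or_pos M with rfl | hM
    · simp only [Function.comp_apply, zero_le, sup_of_le_left, pow_zero, Nat.factorial_zero,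
        Nat.cast_one, Real.one_rpow, mul_one, div_one]
      rcases le_total ‖ξ‖ 1 with h1 | h1
      · calc ‖fourier (v 1) ξ‖ ≤ C * (1 + ‖ξ‖) ^ m := hgrowth ξ
          _ ≤ C * 2 ^ m := by gcongr; linarith
          _ ≤ A' := by
            have : 0 ≤ A + A * h := by positivity
            simp only [A']
            linarith
      · calc ‖fourier (v 1) ξ‖ ≤ A * h / ‖ξ‖ := by
              have := hb 1 le_rfl ξ hξ h0
              simpa [mul_div_assoc] using this
          _ ≤ A * h := div_le_self (by positivity) h1
          _ ≤ A' := by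
            have : 0 ≤ A + C * 2 ^ m := by positivity
            simp only [A']
            linarith
    · simp only [Function.comp_apply, max_eq_right (show 1 ≤ M from hM)]
      exact (hb M hM ξ hξ h0).trans (by gcongr)
  exact hn ⟨Ω, Γ, _, (hloc.comp fun M => max 1 M).comp fun N => ⌊(N : ℝ) ^ (1 / σ)⌋₊,
    HasDecay.of_reindex κ hτ hσ0 (hA.trans_le hA') hh ht hσ hv (B := 1)
      (fun N => by rw [one_mul]; exact floor_rpow_rpow_le hσ0 N) fun N => rfl⟩

end UltraWF

theorem mainTheorem6 {d : ℕ} (U : Opens (UltraWF.Rd d)) (u : 𝓓'(U, ℂ)) (κ : UltraWF.Kind) :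
    UltraWF.WF U u ⊆ UltraWF.WFZeroOne κ U u ∧
    UltraWF.WFZeroOne κ U u ⊆ UltraWF.WFInftyOne κ U u ∧
    UltraWF.WFInftyOne κ U u ⊆ UltraWF.WFZeroInfty κ U u ∧
    UltraWF.WFZeroInfty κ U u ⊆ UltraWF.WFInftyInfty κ U u ∧
    UltraWF.WFInftyInfty κ U u ⊆ ⋂ t ∈ Ioi (1 : ℝ), UltraWF.WFGevrey U u t := by
  refine ⟨?_, ?_, ?_, ?_, ?_⟩
  · exact subset_iInter₂ fun σ hσ => subset_iInter₂ fun τ _ => UltraWF.WF_subset_WFts κ U u hσ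
  · exact iInter₂_mono fun σ _ =>
      (biInter_subset_of_mem (mem_Ioi.2 one_pos)).trans
        (subset_biUnion_of_mem (u := fun τ => UltraWF.WFts κ U u τ σ) (mem_Ioi.2 one_pos))
  · intro p hp
    -- Any pair 1 < σ₁ < σ₂ would do: one τ at σ₂ = 3 gives every τ' at σ₁ = 2.
    obtain ⟨τ, hτ, h⟩ := mem_iUnion₂.1 (mem_iInter₂.1 hp 3 (mem_Ioi.2 (by norm_num)))
    refine mem_iUnion₂.2 ⟨2, mem_Ioi.2 (by norm_num), mem_iInter₂.2 fun τ' hτ' => ?_⟩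
    exact UltraWF.WFts_subset_WFts κ U u hτ' hτ (by norm_num) (by norm_num) h
  · exact iUnion₂_mono fun σ _ =>
      (biInter_subset_of_mem (mem_Ioi.2 one_pos)).trans
        (subset_biUnion_of_mem (u := fun τ => UltraWF.WFts κ U u τ σ) (mem_Ioi.2 one_pos))
  · exact iUnion₂_subset fun σ hσ => iUnion₂_subset fun τ hτ => subset_iInter₂ fun t ht =>
      UltraWF.WFts_subset_WFGevrey κ U u hτ hσ (zero_le_one.trans (le_of_lt ht))
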